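/- All graphs are simple. For a family $F$ of (isomorphism types of) graphs on $r$ vertices and a graph $G$ on $n\ge r$ vertices, let $p(F,G)$ be the number of $r$-subsets of $V(G)$ that induce a subgraph isomorphic to a member of $F$, divided by $\binom{n}{r}$. For a graph $H$, let $i_H(F,n)$ be the maximum of $p(F,G)$ over all $n$-vertex graphs $G$ that contain no (not necessarily induced) subgraph isomorphic to $H$, let $i_H(F)=\lim_{n\to\infty} i_H(F,n)$, and write $i_k(F)=i_{K_k}(F)$. The family $F$ is symmetrizable if, for every $A\in F$ and all distinct nonadjacent vertices $x,y$ of $A$, the graph obtained from $A$ by deleting $x$ and adding a new vertex with the same neighbourhood as $y$ (and not adjacent to $y$) is again, up to isomorphism, in $F$. For real numbers $x_1,\dots,x_\ell>0$ with $x_1+\dots+x_\ell=1$, the complete $\ell$-partite graphon $W=W[x_1,\dots,x_\ell]:[0,1]^2\to\{0,1\}$ is defined by partitioning $[0,1]$ into consecutive intervals of lengths $x_1,\dots,x_\ell$ and letting $W(s,t)=1$ if and only if $s$ and $t$ lie in distinct intervals. A $\{0,1\}$-valued graphon $W$ defines a graph on the points of $[0,1]$, in which distinct $s,t$ are adjacent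 if and only if $W(s,t)=1$; the induced density of $F$ in $W$ is the probability that $r$ independent uniformly random points of $[0,1]$ induce a graph isomorphic to a member of $F$, and $W$ is $H$-free if its graph has no subgraph isomorphic to $H$. **Theorem 1.3.** Let $F$ be a symmetrizable family of graphs on $r$ vertices and let $H$ be a finite graph with at least one edge. Then the limits $i_H(F)$ and $i_{\chi(H)}(F)$ exist and $$i_H(F)=i_{\chi(H)}(F).$$ Moreover, $i_H(F)$ is attained by a complete $\ell$-partite graphon with $\ell<\chi(H)$: there are an integer $1\le\ell<\chi(H)$ and real numbers $x_1,\dots,x_\ell>0$ with $x_1+\dots+x_\ell=1$ such that $W[x_1,\dots,x_\ell]$ is $H$-free and the induced density of $F$ in it equals $i_H(F)$. -/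

import Mathlib

open Filter Topology MeasureTheory

namespace Inducibility

/-- A family `F` of graphs on `r` vertices (each represented, up to isomorphism, on the vertex set
`Fin r`) is *symmetrizable* if it is closed, up to isomorphism, under Zykov symmetrization:
for any two distinct nonadjacent vertices `x, y` of a member `A`, replacing `x` by a copy of `y`
that is not adjacent to `y` gives (a graph isomorphic to) a member of `F`.
In `A.replaceVertex y x` the vertex `x` loses its neighbours and receives those of `y`. -/
def IsSymmetrizable {r : ℕ} (F : Set (SimpleGraph (Fin r))) : Prop :=
  ∀ A ∈ F, ∀ x y : Fin r, x ≠ y → ¬ A.Adj x y →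
    ∃ B ∈ F, Nonempty (A.replaceVertex y x ≃g B)

open Classical in
/-- `P(F, G)`: the number of `r`-subsets of the vertex set of `G` that induce a graph isomorphic
to a member of `F`. -/
noncomputable def copyCount {r n : ℕ} (F : Set (SimpleGraph (Fin r)))
    (G : SimpleGraph (Fin n)) : ℕ :=
  ((Finset.powersetCard r (Finset.univ : Finset (Fin n))).filter
    (fun S => ∃ A ∈ F, Nonempty (G.induce (S : Set (Fin n)) ≃g A))).card

/-- `p(F, G)`: the induced density of the family `F` in the finite graph `G`. -/
noncomputable def density {r n : ℕ} (F : Set (SimpleGraph (Fin r)))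
    (G : SimpleGraph (Fin n)) : ℝ :=
  (copyCount F G : ℝ) / (n.choose r : ℝ)

/-- `i_H(F, n)`: the maximum of `p(F, G)` over all `H`-free graphs `G` on `n` vertices. There are
finitely many such `G`; and at least one (the edgeless graph) as soon as `H` has an edge. -/
noncomputable def maxDensity {V : Type*} (H : SimpleGraph V) {r : ℕ}
    (F : Set (SimpleGraph (Fin r))) (n : ℕ) : ℝ :=
  sSup ((fun G : SimpleGraph (Fin n) => density F G) '' {G | H.Free G})

/-- `i_H(F) = lim_{n → ∞} i_H(F, n)`: the inducibility of `F` over `H`-free graphs. -/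
noncomputable def inducibility {V : Type*} (H : SimpleGraph V) {r : ℕ}
    (F : Set (SimpleGraph (Fin r))) : ℝ :=
  limUnder atTop (maxDensity H F)

/-- A graphon with values in `{0, 1}`: a symmetric measurable function `[0,1]² → {0,1}`. -/
structure Graphon where
  toFun : unitInterval → unitInterval → ℝ
  measurable : Measurable (Function.uncurry toFun)
  symm : ∀ s t, toFun s t = toFun t s
  zero_or_one : ∀ s t, toFun s t = 0 ∨ toFun s t = 1

/-- The graph on the points of `[0,1]` given by a graphon: distinct points `s, t` are adjacent
iff `W(s, t) = 1`. -/
def Graphon.graph (W : Graphon) : SimpleGraph unitInterval where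
  Adj s t := s ≠ t ∧ W.toFun s t = 1
  symm := ⟨fun s t h => ⟨h.1.symm, (W.symm t s).trans h.2⟩⟩
  loopless := ⟨fun _ h => h.1 rfl⟩

/-- The induced density of the family `F` in the graphon `W`: the probability that `r` independent
uniformly random points of `[0,1]` are distinct and induce a graph isomorphic to a member
of `F`. -/
noncomputable def Graphon.density {r : ℕ} (F : Set (SimpleGraph (Fin r))) (W : Graphon) : ℝ :=
  (volume : Measure (Fin r → unitInterval)).real
    {p | Function.Injective p ∧ ∃ A ∈ F, Nonempty (W.graph.comap p ≃g A)}

/-- The `i`-th of the `ℓ` consecutive intervals of sizes `x 0, x 1, …` into which `[0,1]` is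
partitioned; intervals are closed on the left and open on the right, except that the last one
contains the point `1`. -/
def part {ℓ : ℕ} (x : Fin ℓ → ℝ) (i : Fin ℓ) : Set unitInterval :=
  {t | ∑ j ∈ Finset.Iio i, x j ≤ (t : ℝ) ∧
    ((i : ℕ) + 1 < ℓ → (t : ℝ) < ∑ j ∈ Finset.Iic i, x j)}

theorem measurableSet_part {ℓ : ℕ} (x : Fin ℓ → ℝ) (i : Fin ℓ) : MeasurableSet (part x i) := by
  have h1 : MeasurableSet {t : unitInterval | ∑ j ∈ Finset.Iio i, x j ≤ (t : ℝ)} :=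
    measurableSet_le measurable_const measurable_subtype_coe
  have h2 : MeasurableSet {t : unitInterval | (t : ℝ) < ∑ j ∈ Finset.Iic i, x j} :=
    measurableSet_lt measurable_subtype_coe measurable_const
  exact h1.inter ((MeasurableSet.const _).imp h2)

/-- The set of pairs of points that lie in distinct intervals. -/
def crossPairs {ℓ : ℕ} (x : Fin ℓ → ℝ) : Set (unitInterval × unitInterval) :=
  {q | ∃ i j : Fin ℓ, i ≠ j ∧ q.1 ∈ part x i ∧ q.2 ∈ part x j}

theorem measurableSet_crossPairs {ℓ : ℕ} (x : Fin ℓ → ℝ) : MeasurableSet (crossPairs x) := by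
  have h : crossPairs x = ⋃ i : Fin ℓ, ⋃ j : Fin ℓ, ⋃ _ : i ≠ j, part x i ×ˢ part x j := by
    ext q
    simp only [crossPairs, Set.mem_ofPred_eq, Set.mem_iUnion, Set.mem_prod, exists_prop]
  rw [h]
  exact MeasurableSet.iUnion fun i => MeasurableSet.iUnion fun j => MeasurableSet.iUnion fun _ =>
    (measurableSet_part x i).prod (measurableSet_part x j)

/-- The graphon `W[x_1, …, x_ℓ]`, with value `1` at `(s, t)` iff `s` and `t` lie in distinct
intervals of the partition of `[0,1]` into consecutive intervals of sizes `x_1, …, x_ℓ`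
(meant for `x` in the standard simplex). -/
noncomputable def completePartite {ℓ : ℕ} (x : Fin ℓ → ℝ) : Graphon where
  toFun s t := (crossPairs x).indicator 1 (s, t)
  measurable := measurable_one.indicator (measurableSet_crossPairs x)
  symm s t := by
    have h : (s, t) ∈ crossPairs x ↔ (t, s) ∈ crossPairs x :=
      ⟨fun ⟨i, j, hij, hs, ht⟩ => ⟨j, i, hij.symm, ht, hs⟩,
        fun ⟨i, j, hij, hs, ht⟩ => ⟨j, i, hij.symm, ht, hs⟩⟩
    by_cases hst : (s, t) ∈ crossPairs x
    · rw [Set.indicator_of_mem hst, Set.indicator_of_mem (h.1 hst)]; rfl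
    · rw [Set.indicator_of_notMem hst, Set.indicator_of_notMem (fun h' => hst (h.2 h'))]
  zero_or_one s t := Set.indicator_eq_zero_or_self (crossPairs x) 1 (s, t)

end Inducibility

/-! Let `weightedDensity F G w` be the probability that `r` independent vertices of `G` with law `w`
pull `G` back to a member of `F`. For nonadjacent `x, y`, symmetrizability puts this value below the
weighted mean of the values after moving all weight of `y` to `x` and all weight of `x` to `y`
(`weightedDensity_le_merge`), so one of the moves loses nothing. Iterating confines the weight to a
clique (`exists_clique_support`). Hence every weighted graph without `k`-cliques is dominated by a
weighted complete graph on fewer than `k` vertices; let `M` be the maximum over the latter, which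
exists by compactness (`exists_optimal`).

Take `k = χ(H)`. Lower bound: `n` random vertices of the optimal weighted complete graph span an
`ℓ`-partite graph with `ℓ < k`, which is `H`-free, and its expected density is `M`
(`le_maxDensity`). Upper bound: a large `H`-free graph has few `k`-cliques, since a positive
proportion would force a box of cliques, hence a copy of `H` (`card_clique_lt`). So a sample of
fixed size `m` rarely contains a `k`-clique, and a sample without one has density at most `M` up to
a sampling error (`weightedDensity_le_sampling`).

Both limits thus equal `M`, which depends only on `F` and `k`, and `M` is the induced density of a
complete partite graphon (`density_completePartite`). -/

namespace Inducibility

/-! ### Symmetrization of pulled-back graphs -/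

/-- The graph `B` is isomorphic to a member of the family `F`. -/
def MemUpToIso {r : ℕ} (F : Set (SimpleGraph (Fin r))) (B : SimpleGraph (Fin r)) : Prop :=
  ∃ A ∈ F, Nonempty (B ≃g A)

theorem MemUpToIso.replaceVertex {r : ℕ} {F : Set (SimpleGraph (Fin r))} (hF : IsSymmetrizable F)
    {B : SimpleGraph (Fin r)} (hB : MemUpToIso F B) {i j : Fin r} (hij : i ≠ j)
    (h : ¬ B.Adj i j) : MemUpToIso F (B.replaceVertex j i) := by
  obtain ⟨A, hA, ⟨e⟩⟩ := hB
  obtain ⟨C, hC, ⟨f⟩⟩ := hF A hA (e i) (e j) (e.injective.ne hij) (by rwa [e.map_adj_iff])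
  refine ⟨C, hC, ⟨RelIso.trans ⟨e.toEquiv, ?_⟩ f⟩⟩
  intro a b
  have h1 : ∀ a, e.toEquiv a = e i ↔ a = i := fun a => e.injective.eq_iff
  have h2 : ∀ a b, A.Adj (e.toEquiv a) (e.toEquiv b) ↔ B.Adj a b := fun a b => e.map_adj_iff
  have h3 : ∀ a, A.Adj (e.toEquiv a) (e j) ↔ B.Adj a j := fun a => e.map_adj_iff
  have h4 : ∀ a, A.Adj (e j) (e.toEquiv a) ↔ B.Adj j a := fun a => e.map_adj_iff
  simp only [SimpleGraph.replaceVertex, h1, h2, h3, h4]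

/-- The map sending `x` to `y` and fixing everything else. -/
def merge {V : Type*} [DecidableEq V] (x y : V) : V → V := fun v => if v = x then y else v

theorem comap_update {V : Type*} (G : SimpleGraph V) {r : ℕ} (φ : Fin r → V)
    (i j : Fin r) :
    G.comap (Function.update φ i (φ j)) = (G.comap φ).replaceVertex j i := by
  ext a b
  simp only [SimpleGraph.replaceVertex, SimpleGraph.comap_adj, Function.update_apply]
  split_ifs <;> simp_all

/-- The indices sent to `x` are redirected to `y` one at a time, each being a single symmetrization.
This needs an index already at `y` to copy, hence `hy`. -/
theorem MemUpToIso.comap_merge {V : Type*} [DecidableEq V] {r : ℕ} {F : Set (SimpleGraph (Fin r))}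
    (hF : IsSymmetrizable F) {G : SimpleGraph V} {x y : V} (hxy : x ≠ y) (hadj : ¬ G.Adj x y)
    {φ : Fin r → V} (hφ : MemUpToIso F (G.comap φ)) (hy : ∃ j, φ j = y) :
    MemUpToIso F (G.comap (merge x y ∘ φ)) := by
  induction h : (Finset.univ.filter fun i => φ i = x).card generalizing φ with
  | zero =>
    have : merge x y ∘ φ = φ := by
      funext i
      rw [Finset.card_eq_zero, Finset.filter_eq_empty_iff] at h
      simp [merge, h (Finset.mem_univ i)]
    rwa [this]
  | succ n ih =>
    obtain ⟨i, hi⟩ : (Finset.univ.filter fun i => φ i = x).Nonempty := by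
      rw [← Finset.card_pos]; omega
    have hix : φ i = x := (Finset.mem_filter.1 hi).2
    obtain ⟨j, hj⟩ := hy
    have hij : i ≠ j := by rintro rfl; exact hxy (hix.symm.trans hj)
    have hn : ¬ G.Adj (φ i) (φ j) := by rwa [hix, hj]
    have hgood : MemUpToIso F (G.comap (Function.update φ i (φ j))) := by
      rw [comap_update G φ i j]
      exact hφ.replaceVertex hF hij hn
    have hm : merge x y ∘ φ = merge x y ∘ Function.update φ i (φ j) := by
      funext a
      by_cases ha : a = i
      · subst ha; simp [merge, hix, hj]
      · simp [Function.update_of_ne ha]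
    rw [hm]
    refine ih hgood ⟨j, by simp [Function.update_of_ne hij.symm, hj]⟩ ?_
    have : (Finset.univ.filter fun a => Function.update φ i (φ j) a = x)
        = (Finset.univ.filter fun a => φ a = x).erase i := by
      ext a
      by_cases ha : a = i
      · subst ha; simp [hj, hxy.symm]
      · simp [ha]
    rw [this, Finset.card_erase_of_mem hi, h]
    simp

/-! ### Weighted density and moving weight between nonadjacent vertices -/

open Classical in
/-- The probability that a random map `Fin r → V` with independent values distributed according
to `w` pulls back `G` to a member of `F` (up to isomorphism). -/
noncomputable def weightedDensity {V : Type*} [Fintype V] {r : ℕ} (F : Set (SimpleGraph (Fin r)))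
    (G : SimpleGraph V) (w : V → ℝ) : ℝ :=
  ∑ φ : Fin r → V, (∏ i, w (φ i)) * (if MemUpToIso F (G.comap φ) then 1 else 0)

section Pushforward

variable {ι V U : Type*} [Fintype ι] [DecidableEq ι] [Fintype V] [DecidableEq U]

/-- The image of the weight function `w` under `f`. -/
def pushWeight (f : V → U) (w : V → ℝ) (u : U) : ℝ := ∑ v with f v = u, w v

theorem sum_fiber_prod (f : V → U) (w : V → ℝ) (ψ : ι → U) :
    ∑ φ : ι → V with f ∘ φ = ψ, ∏ i, w (φ i) = ∏ i, pushWeight f w (ψ i) := by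
  simp only [pushWeight]
  rw [Finset.prod_univ_sum]
  refine Finset.sum_congr ?_ fun _ _ => rfl
  ext φ
  simp [funext_iff]

theorem sum_prod_mul_comp [Fintype U] (f : V → U) (w : V → ℝ) (g : (ι → U) → ℝ) :
    ∑ φ : ι → V, (∏ i, w (φ i)) * g (f ∘ φ) = ∑ ψ, (∏ i, pushWeight f w (ψ i)) * g ψ := by
  rw [← Finset.sum_fiberwise Finset.univ (fun φ : ι → V => f ∘ φ)]
  refine Finset.sum_congr rfl fun ψ _ => ?_
  rw [← sum_fiber_prod, Finset.sum_mul]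
  refine Finset.sum_congr rfl fun φ hφ => ?_
  rw [(Finset.mem_filter.1 hφ).2]

theorem pushWeight_mem_stdSimplex [Fintype U] (f : V → U) {w : V → ℝ} (hw : w ∈ stdSimplex ℝ V) :
    pushWeight f w ∈ stdSimplex ℝ U := by
  refine ⟨fun u => Finset.sum_nonneg fun v _ => hw.1 v, ?_⟩
  rw [← hw.2, ← Finset.sum_fiberwise Finset.univ f]
  rfl

end Pushforward

theorem le_pushWeight {V U : Type*} [Fintype V] [DecidableEq U] (f : V → U) {w : V → ℝ}
    (hw : ∀ v, 0 ≤ w v) {v : V} {u : U} (h : f v = u) : w v ≤ pushWeight f w u :=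
  Finset.single_le_sum (f := w) (fun v _ => hw v) (by simpa using h)

theorem pushWeight_merge_self {V : Type*} [Fintype V] [DecidableEq V] {x y : V} (hxy : x ≠ y)
    (w : V → ℝ) : pushWeight (merge y x) w x = w x + w y := by
  have : (Finset.univ.filter fun v => merge y x v = x) = {x, y} := by
    ext v
    rw [Finset.mem_filter, Finset.mem_insert, Finset.mem_singleton]
    simp only [merge, Finset.mem_univ, true_and]
    split_ifs <;> simp_all
  rw [pushWeight, this, Finset.sum_pair hxy]

theorem merge_comp_eq_self {ι V : Type*} [DecidableEq V] {x y : V} {φ : ι → V}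
    (h : ¬ ∃ i, φ i = x) : merge x y ∘ φ = φ := by
  funext i
  have : φ i ≠ x := fun hi => h ⟨i, hi⟩
  simp [merge, this]

theorem merge_merge {V : Type*} [DecidableEq V] (x y v : V) :
    merge x y (merge y x v) = merge x y v := by
  simp only [merge]
  split_ifs <;> simp_all

theorem merge_self_merge {V : Type*} [DecidableEq V] (x y v : V) :
    merge x y (merge x y v) = merge x y v := by
  simp only [merge]
  split_ifs <;> simp_all

section Merge

variable {ι V : Type*} [Fintype ι] [DecidableEq ι] [Fintype V] [DecidableEq V]

/-- At the index `i` the pushed weight is exactly `w x + w y`; at all other indices pushing forward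
can only increase the factor. -/
theorem add_mul_prod_le {x y : V} (hxy : x ≠ y) {w : V → ℝ} (hw : ∀ v, 0 ≤ w v)
    {θ ψ : ι → V} (hθ : merge y x ∘ θ = ψ) {i : ι} (hi : ψ i = x) :
    (w x + w y) * ∏ i, w (θ i) ≤ w (θ i) * ∏ i, pushWeight (merge y x) w (ψ i) := by
  rw [← Finset.mul_prod_erase _ _ (Finset.mem_univ i),
    ← Finset.mul_prod_erase _ (fun i => pushWeight (merge y x) w (ψ i)) (Finset.mem_univ i), hi,
    pushWeight_merge_self hxy, mul_left_comm]
  refine mul_le_mul_of_nonneg_left (mul_le_mul_of_nonneg_left ?_ ?_) (hw _)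
  · exact Finset.prod_le_prod (fun _ _ => hw _) fun j _ => le_pushWeight _ hw (congrFun hθ j)
  · exact add_nonneg (hw _) (hw _)

open Classical in
/-- Along the segment that moves weight between `x` and `y`, the probability of an event that is
stable under merging `x` and `y` lies below the chord. -/
theorem sum_le_merge {x y : V} (hxy : x ≠ y) {w : V → ℝ} (hw : ∀ v, 0 ≤ w v)
    (g : (ι → V) → Prop)
    (hg : ∀ φ, g φ → (∃ i, φ i = x) → (∃ i, φ i = y) → g (merge y x ∘ φ) ∧ g (merge x y ∘ φ)) :
    (w x + w y) * ∑ φ : ι → V, (∏ i, w (φ i)) * (if g φ then 1 else 0) ≤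
      w x * ∑ φ : ι → V, (∏ i, w (φ i)) * (if g (merge y x ∘ φ) then 1 else 0) +
      w y * ∑ φ : ι → V, (∏ i, w (φ i)) * (if g (merge x y ∘ φ) then 1 else 0) := by
  simp only [Finset.mul_sum, ← Finset.sum_add_distrib]
  -- The inequality is proved on each class of maps that agree once `y` is merged into `x`; on such
  -- a class both merges are constant.
  rw [← Finset.sum_fiberwise Finset.univ (fun φ : ι → V => merge y x ∘ φ),
    ← Finset.sum_fiberwise Finset.univ (fun φ : ι → V => merge y x ∘ φ)
      (fun φ => w x * _ + w y * _)]
  refine Finset.sum_le_sum fun ψ _ => ?_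
  set ψ' := merge x y ∘ ψ with hψ'
  have hP : ∀ φ : ι → V, 0 ≤ ∏ i, w (φ i) := fun φ => Finset.prod_nonneg fun _ _ => hw _
  have hfib : ∀ φ : ι → V, merge y x ∘ φ = ψ → merge x y ∘ φ = ψ' := by
    rintro φ rfl
    funext i
    simp [hψ', merge_merge]
  -- A good map that meets both `x` and `y` makes both merges good by `hg`; one that misses `x` or
  -- `y` coincides with a merge.
  have key : ∀ φ : ι → V, merge y x ∘ φ = ψ → g φ → φ = ψ ∨ φ = ψ' ∨ (g ψ ∧ g ψ') := by
    intro φ hφ hgφ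
    by_cases h1 : ∃ i, φ i = y
    · by_cases h2 : ∃ i, φ i = x
      · have := hg φ hgφ h2 h1
        rw [hφ, hfib φ hφ] at this
        exact Or.inr (Or.inr this)
      · exact Or.inr (Or.inl ((merge_comp_eq_self h2).symm.trans (hfib φ hφ)))
    · exact Or.inl ((merge_comp_eq_self h1).symm.trans hφ)
  have hsum : ∑ φ : ι → V with merge y x ∘ φ = ψ,
      (w x * ((∏ i, w (φ i)) * (if g (merge y x ∘ φ) then 1 else 0)) +
        w y * ((∏ i, w (φ i)) * (if g (merge x y ∘ φ) then 1 else 0))) =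
      (∏ i, pushWeight (merge y x) w (ψ i)) *
        (w x * (if g ψ then 1 else 0) + w y * (if g ψ' then 1 else 0)) := by
    rw [← sum_fiber_prod, Finset.sum_mul]
    refine Finset.sum_congr rfl fun φ hφ => ?_
    have hφ := (Finset.mem_filter.1 hφ).2
    rw [hfib φ hφ, hφ]
    ring
  have single : ∀ θ : ι → V, merge y x ∘ θ = ψ → g θ →
      (∀ φ : ι → V, merge y x ∘ φ = ψ → g φ → φ = θ) →
      ∑ φ : ι → V with merge y x ∘ φ = ψ, (w x + w y) * ((∏ i, w (φ i)) * (if g φ then 1 else 0))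
        = (w x + w y) * ∏ i, w (θ i) := by
    intro θ hθ hgθ hu
    rw [Finset.sum_eq_single_of_mem θ (by simpa using hθ)]
    · simp [hgθ]
    · intro φ hφ hne
      have : ¬ g φ := fun h => hne (hu φ (Finset.mem_filter.1 hφ).2 h)
      simp [this]
  -- If `ψ` misses `x`, the two merges coincide and the bound holds term by term.
  by_cases hx : ∃ i, ψ i = x
  swap
  · have hψψ : ψ' = ψ := merge_comp_eq_self hx
    refine Finset.sum_le_sum fun φ hφ => ?_
    have hφ := (Finset.mem_filter.1 hφ).2
    rw [hfib φ hφ, hφ, hψψ]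
    have : g φ → g ψ := fun h => by
      rcases key φ hφ h with rfl | rfl | h'
      · exact h
      · rwa [← hψψ]
      · exact h'.1
    have hi : (if g φ then (1 : ℝ) else 0) ≤ if g ψ then 1 else 0 := by
      by_cases h1 : g φ
      · rw [if_pos h1, if_pos (this h1)]
      · rw [if_neg h1]
        split_ifs
        exacts [zero_le_one, le_rfl]
    rw [← add_mul]
    exact mul_le_mul_of_nonneg_left (mul_le_mul_of_nonneg_left hi (hP φ))
      (add_nonneg (hw x) (hw y))
  obtain ⟨i, hi⟩ := hx
  have hψfib : (∃ φ : ι → V, merge y x ∘ φ = ψ) → merge y x ∘ ψ = ψ := by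
    rintro ⟨φ, rfl⟩
    exact funext fun i => merge_self_merge y x (φ i)
  have hψ'fib : (∃ φ : ι → V, merge y x ∘ φ = ψ) → merge y x ∘ ψ' = ψ := by
    rintro ⟨φ, rfl⟩
    exact funext fun i => (merge_merge y x _).trans (merge_self_merge y x (φ i))
  by_cases hne : ∃ φ : ι → V, merge y x ∘ φ = ψ
  swap
  · have : (Finset.univ.filter fun φ : ι → V => merge y x ∘ φ = ψ) = ∅ := by
      rw [Finset.filter_eq_empty_iff]
      exact fun φ _ h => hne ⟨φ, h⟩
    simp [this]
  rw [hsum]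
  -- If both merges are good, the whole class sums to the product of pushed weights. If just one is,
  -- `key` makes it the only good map of the class, and `add_mul_prod_le` bounds its term.
  by_cases h1 : g ψ <;> by_cases h2 : g ψ'
  · rw [← sum_fiber_prod, Finset.sum_mul]
    refine Finset.sum_le_sum fun φ _ => ?_
    have := hP φ; have := hw x; have := hw y
    simp only [h1, h2, if_true, mul_one]
    rw [mul_comm]
    refine mul_le_mul_of_nonneg_right ?_ (by positivity)
    split_ifs <;> simp [hP]
  · rw [single ψ (hψfib hne) h1 fun φ hφ h => ?_]
    · have := add_mul_prod_le hxy hw (hψfib hne) hi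
      rw [hi] at this
      simpa [h1, h2, mul_comm] using this
    · rcases key φ hφ h with h' | rfl | h'
      · exact h'
      · exact absurd h h2
      · exact absurd h'.2 h2
  · rw [single ψ' (hψ'fib hne) h2 fun φ hφ h => ?_]
    · have := add_mul_prod_le hxy hw (hψ'fib hne) hi
      have e : ψ' i = y := by simp [hψ', merge, hi]
      rw [e] at this
      simpa [h1, h2, mul_comm] using this
    · rcases key φ hφ h with rfl | h' | h'
      · exact absurd h h1
      · exact h'
      · exact absurd h'.1 h1
  · simp only [h1, h2, if_false, mul_zero, add_zero]
    refine (Finset.sum_eq_zero fun φ hφ => ?_).le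
    have : ¬ g φ := fun h => by
      rcases key φ (Finset.mem_filter.1 hφ).2 h with rfl | rfl | h'
      · exact h1 h
      · exact h2 h
      · exact h1 h'.1
    simp [this]

end Merge

theorem weightedDensity_le_merge {V : Type*} [Fintype V] [DecidableEq V] {r : ℕ}
    {F : Set (SimpleGraph (Fin r))} (hF : IsSymmetrizable F) (G : SimpleGraph V) {x y : V}
    (hxy : x ≠ y) (hadj : ¬ G.Adj x y) {w : V → ℝ} (hw : ∀ v, 0 ≤ w v) :
    (w x + w y) * weightedDensity F G w ≤
      w x * weightedDensity F G (pushWeight (merge y x) w) +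
      w y * weightedDensity F G (pushWeight (merge x y) w) := by
  have := sum_le_merge hxy hw (fun φ : Fin r → V => MemUpToIso F (G.comap φ)) fun φ h hx hy =>
    ⟨h.comap_merge hF hxy.symm (fun h => hadj h.symm) hx, h.comap_merge hF hxy hadj hy⟩
  classical
  rw [sum_prod_mul_comp (merge y x) w fun φ => if MemUpToIso F (G.comap φ) then (1 : ℝ) else 0,
    sum_prod_mul_comp (merge x y) w fun φ => if MemUpToIso F (G.comap φ) then (1 : ℝ) else 0] at this
  simpa only [weightedDensity] using this

theorem support_pushWeight_merge {V : Type*} [Fintype V] [DecidableEq V] {x y : V} (hxy : x ≠ y)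
    {w : V → ℝ} (hx : w x ≠ 0) (hy : w y ≠ 0) :
    (Finset.univ.filter fun v => pushWeight (merge x y) w v ≠ 0).card <
      (Finset.univ.filter fun v => w v ≠ 0).card := by
  refine Finset.card_lt_card ⟨fun v hv => ?_, fun h => ?_⟩
  · simp only [Finset.mem_filter, Finset.mem_univ, true_and] at hv ⊢
    obtain ⟨u, hu, hu0⟩ := Finset.exists_ne_zero_of_sum_ne_zero hv
    have hu := (Finset.mem_filter.1 hu).2
    simp only [merge] at hu
    split_ifs at hu <;> simp_all
  · have := h (show x ∈ _ by simpa using hx)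
    refine (Finset.mem_filter.1 this).2 (Finset.sum_eq_zero fun v hv => ?_)
    have hv := (Finset.mem_filter.1 hv).2
    simp only [merge] at hv
    split_ifs at hv <;> simp_all

/-- A Motzkin–Straus type argument: the weighted density of a symmetrizable family does not
decrease when the weight is moved in a suitable way onto a clique. -/
theorem exists_clique_support {V : Type*} [Fintype V] {r : ℕ}
    {F : Set (SimpleGraph (Fin r))} (hF : IsSymmetrizable F) (G : SimpleGraph V)
    {w : V → ℝ} (hw : w ∈ stdSimplex ℝ V) :
    ∃ w' ∈ stdSimplex ℝ V, G.IsClique {v | w' v ≠ 0} ∧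
      weightedDensity F G w ≤ weightedDensity F G w' := by
  classical
  induction h : (Finset.univ.filter fun v => w v ≠ 0).card using Nat.strong_induction_on
    generalizing w with
  | _ n ih =>
    by_cases hc : G.IsClique {v | w v ≠ 0}
    · exact ⟨w, hw, hc, le_rfl⟩
    · simp only [SimpleGraph.IsClique, Set.Pairwise, not_forall] at hc
      obtain ⟨x, hx, y, hy, hxy, hadj⟩ := hc
      have hx : w x ≠ 0 := hx
      have hy : w y ≠ 0 := hy
      have hx0 : 0 < w x := lt_of_le_of_ne (hw.1 x) hx.symm
      have hy0 : 0 < w y := lt_of_le_of_ne (hw.1 y) hy.symm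
      have hm := weightedDensity_le_merge hF G hxy hadj hw.1
      by_cases hcase : weightedDensity F G w ≤ weightedDensity F G (pushWeight (merge y x) w)
      · obtain ⟨w', h1, h2, h3⟩ := ih _ (h ▸ support_pushWeight_merge hxy.symm hy hx)
          (pushWeight_mem_stdSimplex (merge y x) hw) rfl
        exact ⟨w', h1, h2, hcase.trans h3⟩
      · obtain ⟨w', h1, h2, h3⟩ := ih _ (h ▸ support_pushWeight_merge hxy hx hy)
          (pushWeight_mem_stdSimplex (merge x y) hw) rfl
        refine ⟨w', h1, h2, le_trans ?_ h3⟩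
        -- One move loses strictly and `w x > 0`, so the chord bound prevents the other from losing.
        push Not at hcase
        have := mul_lt_mul_of_pos_left hcase hx0
        refine le_of_mul_le_mul_left ?_ hy0
        linarith

/-! ### Sampling: finite densities against weighted densities -/

section Marginal

variable {ι κ V : Type*} [Fintype ι] [DecidableEq ι] [Fintype κ] [Fintype V]

/-- Coordinates outside the range of `e` are free, and each sums to `1`. -/
theorem sum_fiber_prod_restrict {w : V → ℝ} (hw : ∑ v, w v = 1) {e : κ → ι}
    (he : Function.Injective e) [DecidableEq V] (ψ : κ → V) :
    ∑ φ : ι → V with φ ∘ e = ψ, ∏ i, w (φ i) = ∏ j, w (ψ j) := by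
  classical
  have h1 : (Finset.univ.filter fun φ : ι → V => φ ∘ e = ψ) =
      Fintype.piFinset fun i => Finset.univ.filter fun v => ∀ j, e j = i → ψ j = v := by
    ext φ
    simp only [Finset.mem_filter, Finset.mem_univ, true_and, Fintype.mem_piFinset]
    constructor
    · rintro rfl i j rfl; rfl
    · exact fun h => funext fun j => (h (e j) j rfl).symm
  rw [h1, ← Finset.prod_univ_sum]
  refine (Fintype.prod_of_injective e he _ _ (fun i hi => ?_) fun j => ?_).symm
  · rw [← hw]
    congr 1
    ext v
    simp only [Finset.mem_filter, Finset.mem_univ, true_and, iff_true]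
    exact fun j hj => absurd ⟨j, hj⟩ hi
  · have : (Finset.univ.filter fun v => ∀ j', e j' = e j → ψ j' = v) = {ψ j} := by
      ext v
      simp only [Finset.mem_filter, Finset.mem_univ, true_and, Finset.mem_singleton]
      constructor
      · exact fun h => (h j rfl).symm
      · rintro rfl j' hj'; rw [he hj']
    rw [this, Finset.sum_singleton]

theorem sum_prod_mul_restrict [DecidableEq κ] {w : V → ℝ} (hw : ∑ v, w v = 1) {e : κ → ι}
    (he : Function.Injective e) (g : (κ → V) → ℝ) :
    ∑ φ : ι → V, (∏ i, w (φ i)) * g (φ ∘ e) = ∑ ψ : κ → V, (∏ j, w (ψ j)) * g ψ := by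
  classical
  rw [← Finset.sum_fiberwise Finset.univ (fun φ : ι → V => φ ∘ e)]
  refine Finset.sum_congr rfl fun ψ _ => ?_
  rw [← sum_fiber_prod_restrict hw he, Finset.sum_mul]
  refine Finset.sum_congr rfl fun φ hφ => ?_
  rw [(Finset.mem_filter.1 hφ).2]

theorem sum_prod_eq_one {w : V → ℝ} (hw : ∑ v, w v = 1) : ∑ φ : ι → V, ∏ i, w (φ i) = 1 := by
  rw [← Fintype.piFinset_univ, ← Finset.prod_univ_sum]
  simp [hw]

end Marginal

open Classical in
/-- The sets that induce a member of `F`, as a filtered family of finsets. -/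
theorem copyCount_eq {r n : ℕ} (F : Set (SimpleGraph (Fin r))) (G : SimpleGraph (Fin n)) :
    copyCount F G = ((Finset.powersetCard r (Finset.univ : Finset (Fin n))).filter
      fun S : Finset (Fin n) =>
        ∃ A ∈ F, Nonempty (G.induce (S : Set (Fin n)) ≃g A)).card := by
  -- `copyCount` unfolds to a filter over a finset of `Set`s, the image of `powersetCard` under
  -- coercion, so injectivity of the coercion is what preserves the cardinality.
  have : Function.Injective fun S : Finset (Fin n) => (S : Set (Fin n)) := Finset.coe_injective
  rw [copyCount, ← Finset.card_image_of_injective _ this]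
  congr 1
  ext S
  simp only [Finset.bind_def, Finset.pure_def, Finset.mem_filter, Finset.mem_sup,
    Finset.mem_singleton, Finset.mem_image]
  constructor
  · rintro ⟨⟨T, hT, rfl⟩, h⟩
    exact ⟨T, ⟨hT, h⟩, rfl⟩
  · rintro ⟨T, ⟨hT, h⟩, rfl⟩
    exact ⟨⟨T, hT, rfl⟩, h⟩

theorem exists_iso_induce_iff {r n : ℕ} (F : Set (SimpleGraph (Fin r)))
    (G : SimpleGraph (Fin n)) {S : Finset (Fin n)} {e : Fin r → Fin n}
    (he : Function.Injective e) (hS : Set.range e = S) :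
    (∃ A ∈ F, Nonempty (G.induce (S : Set (Fin n)) ≃g A)) ↔ MemUpToIso F (G.comap e) := by
  let f : G.comap e ≃g G.induce (S : Set (Fin n)) :=
    ⟨(Equiv.ofInjective e he).trans (Equiv.setCongr hS), Iff.rfl⟩
  constructor
  · rintro ⟨A, hA, ⟨g⟩⟩
    exact ⟨A, hA, ⟨f.trans g⟩⟩
  · rintro ⟨A, hA, ⟨g⟩⟩
    exact ⟨A, hA, ⟨f.symm.trans g⟩⟩

theorem exists_enumeration {r n : ℕ} {S : Finset (Fin n)} (hS : S.card = r) :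
    ∃ e : Fin r → Fin n, Function.Injective e ∧ Set.range e = S :=
  ⟨S.orderEmbOfFin hS, (S.orderEmbOfFin hS).injective, S.range_orderEmbOfFin hS⟩

theorem density_le_one {r n : ℕ} (F : Set (SimpleGraph (Fin r))) (G : SimpleGraph (Fin n)) :
    density F G ≤ 1 := by
  classical
  refine div_le_one_of_le₀ ?_ (by positivity)
  have := Finset.card_filter_le (Finset.powersetCard r (Finset.univ : Finset (Fin n)))
    fun S : Finset (Fin n) => ∃ A ∈ F, Nonempty (G.induce (S : Set (Fin n)) ≃g A)
  rw [Finset.card_powersetCard, Finset.card_univ, Fintype.card_fin] at this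
  rw [copyCount_eq]
  exact_mod_cast this

/-- The expected induced density of a random sample of `m ≥ r` vertices. -/
theorem sum_density_comap {V : Type*} [Fintype V] {r m : ℕ} (hm : r ≤ m)
    (F : Set (SimpleGraph (Fin r))) (G : SimpleGraph V) {w : V → ℝ} (hw : ∑ v, w v = 1) :
    ∑ φ : Fin m → V, (∏ i, w (φ i)) * density F (G.comap φ) = weightedDensity F G w := by
  classical
  have hpos : (0 : ℝ) < m.choose r := by exact_mod_cast Nat.choose_pos hm
  simp only [density, mul_div_assoc']
  rw [← Finset.sum_div, div_eq_iff hpos.ne']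
  have h1 : ∀ φ : Fin m → V, (copyCount F (G.comap φ) : ℝ) =
      ∑ S ∈ Finset.powersetCard r (Finset.univ : Finset (Fin m)),
        if ∃ A ∈ F, Nonempty ((G.comap φ).induce (S : Set (Fin m)) ≃g A) then (1 : ℝ) else 0 := by
    intro φ
    rw [copyCount_eq, Finset.card_filter]
    push_cast
    rfl
  simp only [h1, Finset.mul_sum]
  rw [Finset.sum_comm]
  -- The restriction of a random map to `S` is again a tuple of independent vertices, so every `S`
  -- has the same expectation.
  have h2 : ∀ S ∈ Finset.powersetCard r (Finset.univ : Finset (Fin m)),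
      ∑ φ : Fin m → V, (∏ i, w (φ i)) *
        (if ∃ A ∈ F, Nonempty ((G.comap φ).induce (S : Set (Fin m)) ≃g A) then (1 : ℝ) else 0) =
      weightedDensity F G w := by
    intro S hS
    obtain ⟨e, he, hr⟩ := exists_enumeration (Finset.mem_powersetCard.1 hS).2
    rw [weightedDensity, ← sum_prod_mul_restrict hw he]
    refine Finset.sum_congr rfl fun φ _ => ?_
    rw [← SimpleGraph.comap_comap]
    simp only [exists_iso_induce_iff F (G.comap φ) he hr]
  rw [Finset.sum_congr rfl h2, Finset.sum_const, Finset.card_powersetCard, Finset.card_univ,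
    Fintype.card_fin, nsmul_eq_mul, mul_comm]

-- Each copy has `r!` enumerations. Only an inequality holds in general, as non-injective maps may
-- also pull back to members of `F`.
open Classical in
theorem copyCount_mul_factorial_le {r n : ℕ} (F : Set (SimpleGraph (Fin r)))
    (G : SimpleGraph (Fin n)) :
    copyCount F G * r.factorial ≤
      (Finset.univ.filter fun φ : Fin r → Fin n => MemUpToIso F (G.comap φ)).card := by
  let T := (Finset.powersetCard r (Finset.univ : Finset (Fin n))).filter
    (fun S : Finset (Fin n) => ∃ A ∈ F, Nonempty (G.induce (S : Set (Fin n)) ≃g A))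
  have hT : ∀ S : T, ∃ e : Fin r → Fin n, Function.Injective e ∧ Set.range e = S.1 := fun S =>
    exists_enumeration (Finset.mem_powersetCard.1 (Finset.mem_filter.1 S.2).1).2
  choose e he hr using hT
  have hrange : ∀ (S : T) (π : Equiv.Perm (Fin r)), Set.range (e S ∘ π) = S.1 := fun S π => by
    rw [Set.range_comp, π.surjective.range_eq, Set.image_univ, hr]
  have hcard : Fintype.card (T × Equiv.Perm (Fin r)) = copyCount F G * r.factorial := by
    rw [Fintype.card_prod, Fintype.card_perm, Fintype.card_fin, Fintype.card_coe, copyCount_eq]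
  rw [← hcard, ← Fintype.card_coe]
  refine Fintype.card_le_of_injective
    (fun q => ⟨e q.1 ∘ q.2, Finset.mem_filter.2 ⟨Finset.mem_univ _, ?_⟩⟩) ?_
  · rw [← exists_iso_induce_iff F G ((he q.1).comp q.2.injective) (hrange q.1 q.2)]
    exact (Finset.mem_filter.1 q.1.2).2
  · rintro ⟨S, π⟩ ⟨S', π'⟩ h
    have h : e S ∘ π = e S' ∘ π' := congrArg Subtype.val h
    have hS : S = S' := by
      have := hrange S π
      rw [h, hrange] at this
      exact Subtype.ext (Finset.coe_injective this.symm)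
    subst hS
    congr 1
    ext i
    exact congrArg Fin.val (he S (congrFun h i))

/-- The proportion of non-injective maps among all maps `Fin r → Fin n`. -/
noncomputable def collisionRate (r n : ℕ) : ℝ := 1 - (n.descFactorial r : ℝ) / (n : ℝ) ^ r

theorem tendsto_collisionRate (r : ℕ) : Tendsto (collisionRate r) atTop (𝓝 0) := by
  have h := (isEquivalent_descFactorial r)
  rw [Asymptotics.isEquivalent_iff_tendsto_one] at h
  · rw [show (0 : ℝ) = 1 - 1 by norm_num]
    exact h.const_sub 1
  · filter_upwards [eventually_gt_atTop 0] with n hn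
    positivity

theorem weightedDensity_const {r n : ℕ} (F : Set (SimpleGraph (Fin r)))
    (G : SimpleGraph (Fin n)) [DecidablePred fun φ : Fin r → Fin n => MemUpToIso F (G.comap φ)] :
    weightedDensity F G (fun _ => (n : ℝ)⁻¹) =
      (Finset.univ.filter fun φ : Fin r → Fin n => MemUpToIso F (G.comap φ)).card / (n : ℝ) ^ r := by
  rw [Finset.card_filter]
  push_cast
  rw [Finset.sum_div]
  refine Finset.sum_congr rfl fun φ _ => ?_
  simp only [Finset.prod_const, Finset.card_univ, Fintype.card_fin, inv_pow, div_eq_inv_mul]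
  congr

/-- Sampling with instead of without replacement scales the contribution of injective maps by `1 -
collisionRate r n`; as the density is at most `1`, the loss is at most `collisionRate r n`. -/
theorem density_le {r n : ℕ} (hn : 0 < n) (hr : r ≤ n) (F : Set (SimpleGraph (Fin r)))
    (G : SimpleGraph (Fin n)) :
    density F G ≤ weightedDensity F G (fun _ => (n : ℝ)⁻¹) + collisionRate r n := by
  classical
  have hpos : (0 : ℝ) < (n : ℝ) ^ r := by positivity
  have hch : (0 : ℝ) < n.choose r := by exact_mod_cast Nat.choose_pos hr
  have h1 : density F G * n.descFactorial r = copyCount F G * r.factorial := by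
    rw [density, Nat.descFactorial_eq_factorial_mul_choose]
    push_cast
    field_simp
  have h2 : density F G * n.descFactorial r / (n : ℝ) ^ r ≤
      weightedDensity F G (fun _ => (n : ℝ)⁻¹) := by
    rw [weightedDensity_const, h1]
    gcongr
    exact_mod_cast copyCount_mul_factorial_le F G
  have h3 : 0 ≤ collisionRate r n := by
    rw [collisionRate, sub_nonneg, div_le_one hpos]
    exact_mod_cast Nat.descFactorial_le_pow n r
  have h4 := mul_le_of_le_one_left h3 (density_le_one F G)
  have h5 : density F G * collisionRate r n =
      density F G - density F G * n.descFactorial r / (n : ℝ) ^ r := by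
    rw [collisionRate]; ring
  linarith

theorem uniform_mem_stdSimplex {n : ℕ} (hn : 0 < n) :
    (fun _ => (n : ℝ)⁻¹) ∈ stdSimplex ℝ (Fin n) := by
  refine ⟨fun _ => by positivity, ?_⟩
  have : (n : ℝ) ≠ 0 := by positivity
  simp [this]

/-! ### The optimal weighted complete graph -/

theorem weightedDensity_comap {V U : Type*} [Fintype V] [Fintype U] {r : ℕ}
    (F : Set (SimpleGraph (Fin r))) (G : SimpleGraph V) {w : V → ℝ} {e : U → V}
    (he : Function.Injective e) (hw : ∀ v ∉ Set.range e, w v = 0) :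
    weightedDensity F (G.comap e) (w ∘ e) = weightedDensity F G w := by
  refine Fintype.sum_of_injective (fun φ : Fin r → U => e ∘ φ) he.comp_left _ _ (fun φ hφ => ?_)
    fun φ => rfl
  have : ∃ i, φ i ∉ Set.range e := by
    by_contra! h
    choose ψ hψ using h
    exact hφ ⟨ψ, funext hψ⟩
  obtain ⟨i, hi⟩ := this
  rw [Finset.prod_eq_zero (Finset.mem_univ i) (hw _ hi), zero_mul]

/-- Vertices of weight zero contribute nothing; deleting them leaves a complete graph, whose size is
that of a clique of `G`. -/
theorem exists_pos_weights {V : Type*} [Fintype V] {r : ℕ} (F : Set (SimpleGraph (Fin r)))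
    {G : SimpleGraph V} {w : V → ℝ} (hw : w ∈ stdSimplex ℝ V) (hc : G.IsClique {v | w v ≠ 0}) :
    ∃ (s : ℕ) (x : Fin s → ℝ), x ∈ stdSimplex ℝ (Fin s) ∧ (∀ i, 0 < x i) ∧ ¬ G.CliqueFree s ∧
      weightedDensity F (⊤ : SimpleGraph (Fin s)) x = weightedDensity F G w := by
  classical
  let S : Finset V := Finset.univ.filter fun v => w v ≠ 0
  let e : Fin S.card → V := fun i => (S.equivFin.symm i).1
  have he : Function.Injective e := Subtype.val_injective.comp S.equivFin.symm.injective
  have hrange : ∀ v ∉ Set.range e, w v = 0 := by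
    intro v hv
    by_contra h
    exact hv ⟨S.equivFin ⟨v, by simpa [S] using h⟩, by simp [e]⟩
  have hS : ∀ i, w (e i) ≠ 0 := fun i => (Finset.mem_filter.1 (S.equivFin.symm i).2).2
  have hG : G.comap e = ⊤ := by
    ext i j
    simp only [SimpleGraph.comap_adj, SimpleGraph.top_adj]
    exact ⟨fun h hij => G.ne_of_adj h (congrArg e hij), fun h => hc (hS i) (hS j) (he.ne h)⟩
  refine ⟨S.card, w ∘ e, ⟨fun i => hw.1 _, ?_⟩, fun i => lt_of_le_of_ne (hw.1 _) (hS i).symm,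
    fun h => h S ⟨by simpa [S] using hc, rfl⟩, ?_⟩
  · rw [← hw.2]
    exact Fintype.sum_of_injective e he _ _ hrange fun _ => rfl
  · rw [← hG, weightedDensity_comap F G he hrange]

theorem continuous_weightedDensity {V : Type*} [Fintype V] {r : ℕ}
    (F : Set (SimpleGraph (Fin r))) (G : SimpleGraph V) : Continuous (weightedDensity F G) := by
  unfold weightedDensity
  fun_prop

/-- Among complete multipartite graphons with fewer than `k` parts, there is an optimal one. -/
theorem exists_optimal {r : ℕ} (F : Set (SimpleGraph (Fin r))) {k : ℕ} (hk : 2 ≤ k) :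
    ∃ ℓ < k, ∃ x ∈ stdSimplex ℝ (Fin ℓ), (∀ i, 0 < x i) ∧
      ∀ ℓ' < k, ∀ y ∈ stdSimplex ℝ (Fin ℓ'),
        weightedDensity F (⊤ : SimpleGraph (Fin ℓ')) y ≤
          weightedDensity F (⊤ : SimpleGraph (Fin ℓ)) x := by
  let K : Set ℝ := ⋃ ℓ ∈ Finset.range k,
    weightedDensity F (⊤ : SimpleGraph (Fin ℓ)) '' stdSimplex ℝ (Fin ℓ)
  have hK : IsCompact K := Finset.isCompact_biUnion _ fun ℓ _ =>
    (isCompact_stdSimplex ℝ (Fin ℓ)).image (continuous_weightedDensity F _)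
  -- The simplex on `Fin 0` is empty, so `2 ≤ k` is needed to make `ℓ = 1` available.
  have hne : K.Nonempty := by
    refine ⟨_, Set.mem_biUnion (Finset.mem_coe.2 (Finset.mem_range.2 hk))
      ⟨fun _ => ((1 : ℕ) : ℝ)⁻¹, uniform_mem_stdSimplex one_pos, rfl⟩⟩
  obtain ⟨M, hM, hmax⟩ := hK.exists_isGreatest hne
  simp only [K, Set.mem_iUnion, Finset.mem_range] at hM
  obtain ⟨ℓ, hℓ, x, hx, rfl⟩ := hM
  -- The maximizer may lie on the boundary of its simplex; discarding zero weights gives positive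
  -- ones and no more parts.
  obtain ⟨s, x', hx', hpos, hs, hQ⟩ := exists_pos_weights F hx
    (G := (⊤ : SimpleGraph (Fin ℓ))) (fun _ _ _ _ h => h)
  have hsℓ : s ≤ ℓ := by
    by_contra! h
    exact hs (SimpleGraph.cliqueFree_of_card_lt (by simpa using h))
  refine ⟨s, hsℓ.trans_lt hℓ, x', hx', hpos, fun ℓ' hℓ' y hy => ?_⟩
  rw [hQ]
  exact hmax (Set.mem_biUnion (Finset.mem_coe.2 (Finset.mem_range.2 hℓ')) ⟨y, hy, rfl⟩)

theorem weightedDensity_le_of_cliqueFree {V : Type*} [Fintype V] {r : ℕ}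
    {F : Set (SimpleGraph (Fin r))} (hF : IsSymmetrizable F) {G : SimpleGraph V} {k : ℕ}
    (hG : G.CliqueFree k) {M : ℝ}
    (hM : ∀ ℓ < k, ∀ y ∈ stdSimplex ℝ (Fin ℓ), weightedDensity F (⊤ : SimpleGraph (Fin ℓ)) y ≤ M)
    {w : V → ℝ} (hw : w ∈ stdSimplex ℝ V) : weightedDensity F G w ≤ M := by
  obtain ⟨w', hw', hc, hle⟩ := exists_clique_support hF G hw
  obtain ⟨s, x, hx, -, hs, hQ⟩ := exists_pos_weights F hw' hc
  refine hle.trans (hQ ▸ hM s ?_ x hx)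
  by_contra! h
  exact hs (hG.mono h)

theorem bddAbove_density {V : Type*} (H : SimpleGraph V) {r n : ℕ}
    (F : Set (SimpleGraph (Fin r))) :
    BddAbove ((fun G : SimpleGraph (Fin n) => density F G) '' {G | H.Free G}) := by
  refine ⟨1, ?_⟩
  rintro _ ⟨G, -, rfl⟩
  exact density_le_one F G

theorem free_comap_top {V U W : Type*} {H : SimpleGraph V} {f : W → U}
    (hH : IsEmpty (H →g (⊤ : SimpleGraph U))) : H.Free ((⊤ : SimpleGraph U).comap f) := by
  rintro ⟨c⟩
  exact hH.false ((SimpleGraph.Hom.comap f ⊤).comp c.toHom)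

/-- An average of the densities of `H`-free graphs on `n` vertices cannot exceed their maximum. -/
theorem le_maxDensity {V : Type*} (H : SimpleGraph V) {r n ℓ : ℕ} (hn : r ≤ n)
    (F : Set (SimpleGraph (Fin r))) {x : Fin ℓ → ℝ} (hx : x ∈ stdSimplex ℝ (Fin ℓ))
    (hpos : ∀ i, 0 < x i) (hH : ¬ H.Colorable ℓ) :
    weightedDensity F (⊤ : SimpleGraph (Fin ℓ)) x ≤ maxDensity H F n := by
  have hfree : ∀ φ : Fin n → Fin ℓ, H.Free ((⊤ : SimpleGraph (Fin ℓ)).comap φ) := fun φ =>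
    free_comap_top ⟨fun f => hH ⟨f⟩⟩
  rw [← sum_density_comap hn F (⊤ : SimpleGraph (Fin ℓ)) hx.2]
  calc _ ≤ ∑ φ : Fin n → Fin ℓ, (∏ i, x (φ i)) * maxDensity H F n := by
        refine Finset.sum_le_sum fun φ _ => mul_le_mul_of_nonneg_left ?_
          (Finset.prod_nonneg fun i _ => (hpos _).le)
        exact le_csSup (bddAbove_density H F) ⟨_, hfree φ, rfl⟩
    _ = _ := by rw [← Finset.sum_mul, sum_prod_eq_one hx.2, one_mul]

/-! ### Few `k`-cliques in `H`-free graphs -/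

theorem card_not_injective {t n : ℕ} (hn : 0 < n)
    [DecidablePred fun y : Fin t → Fin n => ¬ Function.Injective y] :
    ((Finset.univ.filter fun y : Fin t → Fin n => ¬ Function.Injective y).card : ℝ) =
      collisionRate t n * (n : ℝ) ^ t := by
  classical
  have h1 : (Finset.univ.filter fun y : Fin t → Fin n => Function.Injective y).card =
      n.descFactorial t := by
    rw [← Fintype.card_subtype, Fintype.card_congr (Equiv.subtypeInjectiveEquivEmbedding _ _),
      Fintype.card_embedding_eq, Fintype.card_fin, Fintype.card_fin]
  have h2 := Finset.card_filter_add_card_filter_not (s := (Finset.univ : Finset (Fin t → Fin n)))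
    (fun y => Function.Injective y)
  rw [h1, Finset.card_univ, Fintype.card_fun, Fintype.card_fin, Fintype.card_fin] at h2
  have h3 : (n.descFactorial t : ℝ) + (Finset.univ.filter
      fun y : Fin t → Fin n => ¬ Function.Injective y).card = (n : ℝ) ^ t := by
    rw [← Nat.cast_pow, ← h2, Nat.cast_add]
  have hpos : (0 : ℝ) < (n : ℝ) ^ t := by positivity
  rw [collisionRate, sub_mul, div_mul_cancel₀ _ hpos.ne', one_mul]
  linarith

open Classical in
/-- A bipartite double counting step: a dense relation contains a rectangle with `t + 1` rows
and a positive proportion of the columns. -/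
theorem exists_rows (t : ℕ) {c : ℝ} (hc : 0 < c) :
    ∃ N : ℕ, ∀ n ≥ N, ∀ {X : Type} [Fintype X] [Nonempty X] (R : Fin n → X → Prop),
      c * (n * Fintype.card X) ≤ ∑ x, ((Finset.univ.filter fun y => R y x).card : ℝ) →
      ∃ y : Fin (t + 1) → Fin n, Function.Injective y ∧
        c ^ (t + 1) / 2 * Fintype.card X ≤
          (Finset.univ.filter fun x => ∀ j, R (y j) x).card := by
  -- The power mean inequality yields total mass `c ^ (t + 1)`; non-injective tuples must take less
  -- than half of it.
  have hev : ∀ᶠ n in atTop, collisionRate (t + 1) n < c ^ (t + 1) / 2 :=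
    (tendsto_collisionRate (t + 1)).eventually_lt_const (by positivity)
  obtain ⟨N, hN⟩ := eventually_atTop.1 (hev.and (eventually_gt_atTop 0))
  refine ⟨N, fun n hn X _ _ R hR => ?_⟩
  obtain ⟨hcoll, hn0⟩ := hN n hn
  have hX0 : (0 : ℝ) < Fintype.card X := by exact_mod_cast Fintype.card_pos
  have hn1 : (0 : ℝ) < (n : ℝ) ^ (t + 1) := by positivity
  by_contra! hcon
  have hswap : ∑ y : Fin (t + 1) → Fin n,
      ((Finset.univ.filter fun x => ∀ j, R (y j) x).card : ℝ) =
      ∑ x, ((Finset.univ.filter fun y => R y x).card : ℝ) ^ (t + 1) := by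
    have h : ∀ x, (Finset.univ.filter fun y => R y x).card ^ (t + 1) =
        (Finset.univ.filter fun y : Fin (t + 1) → Fin n => ∀ j, R (y j) x).card := by
      intro x
      have : (Finset.univ.filter fun y : Fin (t + 1) → Fin n => ∀ j, R (y j) x) =
          Fintype.piFinset fun _ => Finset.univ.filter fun y => R y x := by
        ext y; simp
      rw [this, Fintype.card_piFinset, Finset.prod_const, Finset.card_univ, Fintype.card_fin]
    rw [Finset.sum_congr rfl fun x _ => (Nat.cast_pow _ _).symm.trans (congrArg Nat.cast (h x))]
    simp only [Finset.card_filter]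
    push_cast
    exact Finset.sum_comm
  have hpow := pow_sum_div_card_le_sum_pow (s := (Finset.univ : Finset X))
    (f := fun x => ((Finset.univ.filter fun y => R y x).card : ℝ)) (fun _ _ => by positivity) t
  rw [← hswap, Finset.card_univ] at hpow
  have hlow : c ^ (t + 1) * (n : ℝ) ^ (t + 1) * Fintype.card X ≤
      ∑ y : Fin (t + 1) → Fin n, ((Finset.univ.filter fun x => ∀ j, R (y j) x).card : ℝ) := by
    refine le_trans ?_ hpow
    rw [le_div_iff₀ (by positivity)]
    calc _ = (c * (n * Fintype.card X)) ^ (t + 1) := by ring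
      _ ≤ _ := pow_le_pow_left₀ (by positivity) hR _
  have hup : ∑ y : Fin (t + 1) → Fin n,
      ((Finset.univ.filter fun x => ∀ j, R (y j) x).card : ℝ) ≤
      ∑ y : Fin (t + 1) → Fin n, (c ^ (t + 1) / 2 * Fintype.card X +
        (if ¬ Function.Injective y then 1 else 0) * Fintype.card X) := by
    refine Finset.sum_le_sum fun y _ => ?_
    by_cases hy : Function.Injective y
    · simpa [hy] using (hcon y hy).le
    · have : ((Finset.univ.filter fun x => ∀ j, R (y j) x).card : ℝ) ≤ Fintype.card X := by
        exact_mod_cast Finset.card_le_univ _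
      have : 0 ≤ c ^ (t + 1) / 2 * Fintype.card X := by positivity
      rw [if_pos hy]
      linarith
  rw [Finset.sum_add_distrib, Finset.sum_const, ← Finset.sum_mul, Finset.sum_boole,
    card_not_injective hn0, Finset.card_univ, Fintype.card_fun, Fintype.card_fin, Fintype.card_fin,
    nsmul_eq_mul, Nat.cast_pow] at hup
  have hlt := mul_lt_mul_of_pos_right hcoll (mul_pos hn1 hX0)
  linarith

open Classical in
/-- A dense `k`-ary relation on a large set contains a large box. -/
theorem exists_box (t k : ℕ) : ∀ {c : ℝ}, 0 < c →
    ∃ N : ℕ, ∀ n ≥ N, ∀ R : (Fin k → Fin n) → Prop,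
      c * (n : ℝ) ^ k ≤ (Finset.univ.filter R).card →
      ∃ a : Fin k → Fin (t + 1) → Fin n, (∀ i, Function.Injective (a i)) ∧
        ∀ j : Fin k → Fin (t + 1), R fun i => a i (j i) := by
  induction k with
  | zero =>
    refine fun {c} hc => ⟨0, fun n _ R hR => ⟨fun i => i.elim0, fun i => i.elim0, fun j => ?_⟩⟩
    have : (Finset.univ.filter R).Nonempty := by
      rw [← Finset.card_pos]
      have : (0 : ℝ) < (Finset.univ.filter R).card := by
        refine lt_of_lt_of_le ?_ hR
        simpa using hc
      exact_mod_cast this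
    obtain ⟨φ, hφ⟩ := this
    convert (Finset.mem_filter.1 hφ).2
  | succ k ih =>
    intro c hc
    obtain ⟨N₁, h₁⟩ := exists_rows t hc
    obtain ⟨N₂, h₂⟩ := ih (c := c ^ (t + 1) / 2) (by positivity)
    refine ⟨max (max N₁ N₂) 1, fun n hn R hR => ?_⟩
    have hn0 : 0 < n := lt_of_lt_of_le one_pos ((le_max_right _ _).trans hn)
    have hn1 : N₁ ≤ n := (le_max_left _ _).trans ((le_max_left _ _).trans hn)
    have hn2 : N₂ ≤ n := (le_max_right _ _).trans ((le_max_left _ _).trans hn)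
    have : Nonempty (Fin k → Fin n) := ⟨fun _ => ⟨0, hn0⟩⟩
    have hsum : ((Finset.univ.filter R).card : ℝ) = ∑ x : Fin k → Fin n,
        ((Finset.univ.filter fun y => R (Fin.cons y x)).card : ℝ) := by
      simp only [Finset.card_filter]
      push_cast
      rw [Finset.sum_comm, ← Fintype.sum_prod_type']
      exact (Fintype.sum_equiv (Fin.consEquiv fun _ => Fin n) _ _ fun _ => rfl).symm
    -- The columns are the tuples of the remaining `k` coordinates, so the first side of the box
    -- comes from the rows and the others by induction.
    obtain ⟨y, hy, hcard⟩ := h₁ n hn1 (X := Fin k → Fin n) (fun y x => R (Fin.cons y x)) (by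
      rw [← hsum, Fintype.card_fun, Fintype.card_fin, Fintype.card_fin]
      refine le_trans (le_of_eq ?_) hR
      push_cast
      ring)
    rw [Fintype.card_fun, Fintype.card_fin, Fintype.card_fin, Nat.cast_pow] at hcard
    obtain ⟨a, ha, hbox⟩ := h₂ n hn2 (fun x => ∀ j, R (Fin.cons (y j) x)) (by convert hcard)
    refine ⟨Fin.cons y a, fun i => ?_, fun j => ?_⟩
    · refine Fin.cases ?_ (fun i => ?_) i
      · simpa using hy
      · simpa using ha i
    · have := hbox (Fin.tail j) (j 0)
      convert this using 1
      funext i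
      refine Fin.cases ?_ (fun i => ?_) i
      · simp
      · simp [Fin.tail]

open Classical in
/-- A large graph without a copy of a fixed `k`-colourable graph has few cliques of size `k`. -/
theorem card_clique_lt {V : Type*} [Finite V] {H : SimpleGraph V} {k : ℕ} (hH : H.Colorable k)
    {c : ℝ} (hc : 0 < c) :
    ∃ N : ℕ, ∀ n ≥ N, ∀ G : SimpleGraph (Fin n), H.Free G →
      ((Finset.univ.filter fun φ : Fin k → Fin n => G.comap φ = ⊤).card : ℝ) <
        c * (n : ℝ) ^ k := by
  obtain ⟨t, ⟨e⟩⟩ := Finite.exists_equiv_fin V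
  obtain ⟨C⟩ := hH
  obtain ⟨N, hN⟩ := exists_box t k hc
  refine ⟨N, fun n hn G hG => ?_⟩
  by_contra! hcon
  obtain ⟨a, ha, hbox⟩ := hN n hn (fun φ => G.comap φ = ⊤) hcon
  -- `H` has `t` vertices and the box has sides of length `t + 1`, so each colour class of `H` fits
  -- into its own side.
  let u : V → Fin (t + 1) := fun v => (e v).castSucc
  have hu : Function.Injective u := (Fin.castSucc_injective t).comp e.injective
  have hadj : ∀ v v', C v ≠ C v' → G.Adj (a (C v) (u v)) (a (C v') (u v')) := by
    intro v v' h
    have := hbox fun i => if i = C v then u v else u v'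
    have h' : (G.comap fun i => a i (if i = C v then u v else u v')).Adj (C v) (C v') := by
      rw [this]; exact h
    simpa [h.symm] using h'
  refine hG ⟨⟨⟨fun v => a (C v) (u v), fun {v v'} h => hadj v v' (C.valid h)⟩, fun v v' h => ?_⟩⟩
  have h : a (C v) (u v) = a (C v') (u v') := h
  by_cases hC : C v = C v'
  · rw [hC] at h
    exact hu (ha _ h)
  · exact absurd h (G.ne_of_adj (hadj v v' hC))

/-! ### The upper bound for `H`-free graphs -/

theorem exists_comap_eq_top {V : Type*} {G : SimpleGraph V} {k : ℕ} (h : ¬ G.CliqueFree k) :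
    ∃ e : Fin k ↪ V, G.comap e = ⊤ := by
  rw [SimpleGraph.not_cliqueFree_iff_top_isContained] at h
  obtain ⟨f⟩ := h
  refine ⟨⟨f, f.injective⟩, ?_⟩
  ext i j
  exact ⟨fun h hij => G.ne_of_adj h (congrArg f hij), fun h => f.toHom.map_adj h⟩

theorem weightedDensity_nonneg {V : Type*} [Fintype V] {r : ℕ} (F : Set (SimpleGraph (Fin r)))
    (G : SimpleGraph V) {w : V → ℝ} (hw : ∀ v, 0 ≤ w v) : 0 ≤ weightedDensity F G w :=
  Finset.sum_nonneg fun φ _ => mul_nonneg (Finset.prod_nonneg fun i _ => hw _)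
    (by split_ifs <;> norm_num)

open Classical in
/-- Sampling `m` vertices bounds the weighted density in terms of the clique density. -/
theorem weightedDensity_le_sampling {V : Type*} [Fintype V] {r m k : ℕ} (hm0 : 0 < m) (hm : r ≤ m)
    {F : Set (SimpleGraph (Fin r))} (hF : IsSymmetrizable F) (G : SimpleGraph V) {M : ℝ}
    (hM0 : 0 ≤ M)
    (hM : ∀ ℓ < k, ∀ y ∈ stdSimplex ℝ (Fin ℓ), weightedDensity F (⊤ : SimpleGraph (Fin ℓ)) y ≤ M)
    {w : V → ℝ} (hw : w ∈ stdSimplex ℝ V) :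
    weightedDensity F G w ≤ M + collisionRate r m + (m : ℝ) ^ k *
      ∑ ψ : Fin k → V, (∏ i, w (ψ i)) * (if G.comap ψ = ⊤ then 1 else 0) := by
  set q := ∑ ψ : Fin k → V, (∏ i, w (ψ i)) * (if G.comap ψ = ⊤ then (1 : ℝ) else 0) with hq
  have hP : ∀ {s : ℕ} (φ : Fin s → V), 0 ≤ ∏ i, w (φ i) := fun φ =>
    Finset.prod_nonneg fun _ _ => hw.1 _
  have hq0 : 0 ≤ q := Finset.sum_nonneg fun ψ _ => mul_nonneg (hP ψ) (by split_ifs <;> norm_num)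
  have hcoll : 0 ≤ collisionRate r m := by
    rw [collisionRate, sub_nonneg, div_le_one (by positivity)]
    exact_mod_cast Nat.descFactorial_le_pow m r
  -- On a clique-free sample the bound `M` applies; otherwise the number of embedded `k`-cliques is
  -- at least `1`, which already exceeds the density.
  have hpt : ∀ φ : Fin m → V, density F (G.comap φ) ≤ M + collisionRate r m +
      ∑ e : Fin k ↪ Fin m, if G.comap (φ ∘ e) = ⊤ then (1 : ℝ) else 0 := by
    intro φ
    by_cases hc : (G.comap φ).CliqueFree k
    · have h1 := density_le hm0 hm F (G.comap φ)
      have h2 := weightedDensity_le_of_cliqueFree hF hc hM (uniform_mem_stdSimplex hm0)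
      have h3 : 0 ≤ ∑ e : Fin k ↪ Fin m, if G.comap (φ ∘ e) = ⊤ then (1 : ℝ) else 0 :=
        Finset.sum_nonneg fun _ _ => by split_ifs <;> norm_num
      linarith
    · obtain ⟨e, he⟩ := exists_comap_eq_top hc
      have h1 : (1 : ℝ) ≤ ∑ e : Fin k ↪ Fin m, if G.comap (φ ∘ e) = ⊤ then (1 : ℝ) else 0 := by
        refine le_trans (le_of_eq ?_) (Finset.single_le_sum
          (f := fun e : Fin k ↪ Fin m => if G.comap (φ ∘ e) = ⊤ then (1 : ℝ) else 0)
          (fun _ _ => by split_ifs <;> norm_num) (Finset.mem_univ e))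
        rw [SimpleGraph.comap_comap] at he
        simp [he]
      have h2 := density_le_one F (G.comap φ)
      linarith
  have hcard : (Fintype.card (Fin k ↪ Fin m) : ℝ) ≤ (m : ℝ) ^ k := by
    rw [Fintype.card_embedding_eq, Fintype.card_fin, Fintype.card_fin]
    exact_mod_cast Nat.descFactorial_le_pow m k
  rw [← sum_density_comap hm F G hw.2]
  calc _ ≤ ∑ φ : Fin m → V, (∏ i, w (φ i)) * (M + collisionRate r m +
        ∑ e : Fin k ↪ Fin m, if G.comap (φ ∘ e) = ⊤ then (1 : ℝ) else 0) :=
        Finset.sum_le_sum fun φ _ => mul_le_mul_of_nonneg_left (hpt φ) (hP φ)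
    _ = M + collisionRate r m + ∑ e : Fin k ↪ Fin m, q := by
        simp only [mul_add (∏ i, w _) (M + _), Finset.sum_add_distrib, Finset.mul_sum]
        rw [← Finset.sum_mul, sum_prod_eq_one hw.2, one_mul, Finset.sum_comm]
        congr 1
        refine Finset.sum_congr rfl fun e _ => ?_
        exact sum_prod_mul_restrict hw.2 e.injective
          fun ψ => if G.comap ψ = ⊤ then (1 : ℝ) else 0
    _ ≤ _ := by
        rw [Finset.sum_const, Finset.card_univ, nsmul_eq_mul]
        gcongr

/-- Three errors of `ε / 3`: replacement in the `n`-vertex graph, replacement in the sample, and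
`k`-cliques in the sample. The sample size `m` is fixed first, so the factor `m ^ k` is a constant
when `n` grows. -/
theorem eventually_maxDensity_le {V : Type*} [Finite V] {H : SimpleGraph V} (hne : H ≠ ⊥) {k : ℕ}
    (hH : H.Colorable k) {r : ℕ} {F : Set (SimpleGraph (Fin r))} (hF : IsSymmetrizable F) {M : ℝ}
    (hM0 : 0 ≤ M)
    (hM : ∀ ℓ < k, ∀ y ∈ stdSimplex ℝ (Fin ℓ), weightedDensity F (⊤ : SimpleGraph (Fin ℓ)) y ≤ M)
    {ε : ℝ} (hε : 0 < ε) : ∀ᶠ n in atTop, maxDensity H F n ≤ M + ε := by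
  classical
  have hcoll : ∀ᶠ n in atTop, collisionRate r n < ε / 3 :=
    (tendsto_collisionRate r).eventually_lt_const (by positivity)
  obtain ⟨m, hm, hrm, hm0⟩ :=
    (hcoll.and ((eventually_ge_atTop r).and (eventually_gt_atTop 0))).exists
  have hmk : (0 : ℝ) < (m : ℝ) ^ k := by positivity
  obtain ⟨N, hN⟩ := card_clique_lt hH (c := ε / 3 / (m : ℝ) ^ k) (by positivity)
  filter_upwards [hcoll, eventually_ge_atTop r, eventually_gt_atTop 0, eventually_ge_atTop N]
    with n hn hrn hn0 hNn
  have hnk : (0 : ℝ) < (n : ℝ) ^ k := by positivity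
  refine csSup_le ⟨_, ⊥, ?_, rfl⟩ ?_
  · rintro ⟨f⟩
    obtain ⟨a, b, hab⟩ := SimpleGraph.ne_bot_iff_exists_adj.1 hne
    exact f.toHom.map_adj hab
  · rintro _ ⟨G, hG, rfl⟩
    have h1 := density_le hn0 hrn F G
    have h2 := weightedDensity_le_sampling hm0 hrm hF G hM0 hM (uniform_mem_stdSimplex hn0)
    have h3 : ∑ ψ : Fin k → Fin n, (∏ _i : Fin k, (n : ℝ)⁻¹) *
        (if G.comap ψ = ⊤ then (1 : ℝ) else 0) ≤ ε / 3 / (m : ℝ) ^ k := by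
      rw [← Finset.mul_sum, Finset.sum_boole, Finset.prod_const, Finset.card_univ,
        Fintype.card_fin, inv_pow, inv_mul_le_iff₀ hnk, mul_comm]
      exact (hN n hNn G hG).le
    have h4 := mul_le_mul_of_nonneg_left h3 hmk.le
    rw [mul_div_cancel₀ _ hmk.ne'] at h4
    linarith

/-! ### Complete partite graphons -/

section Parts

variable {ℓ : ℕ} {x : Fin ℓ → ℝ}

theorem part_disjoint (hx : x ∈ stdSimplex ℝ (Fin ℓ)) {t : unitInterval} {i j : Fin ℓ}
    (hi : t ∈ part x i) (hj : t ∈ part x j) : i = j := by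
  have key : ∀ {i j : Fin ℓ}, t ∈ part x i → t ∈ part x j → ¬ i < j := by
    intro i j hi hj hij
    have h1 := hi.2 (by omega)
    have h2 : ∑ a ∈ Finset.Iic i, x a ≤ ∑ a ∈ Finset.Iio j, x a :=
      Finset.sum_le_sum_of_subset_of_nonneg
        (fun a ha => Finset.mem_Iio.2 ((Finset.mem_Iic.1 ha).trans_lt hij)) fun _ _ _ => hx.1 _
    exact absurd (h1.trans_le h2) (not_lt.2 hj.1)
  exact le_antisymm (not_lt.1 (key hj hi)) (not_lt.1 (key hi hj))

theorem exists_mem_part (hx : x ∈ stdSimplex ℝ (Fin ℓ)) (t : unitInterval) :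
    ∃ i, t ∈ part x i := by
  have hℓ : 0 < ℓ := by
    rcases Nat.eq_zero_or_pos ℓ with rfl | h
    · simpa using hx.2
    · exact h
  -- The part containing `t` is the last one whose left endpoint is at most `t`.
  let T : Finset (Fin ℓ) := Finset.univ.filter fun i => ∑ j ∈ Finset.Iio i, x j ≤ (t : ℝ)
  have hT : T.Nonempty := by
    refine ⟨⟨0, hℓ⟩, Finset.mem_filter.2 ⟨Finset.mem_univ _, ?_⟩⟩
    have : Finset.Iio (⟨0, hℓ⟩ : Fin ℓ) = ∅ := by
      ext a; simp [Fin.lt_def]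
    rw [this, Finset.sum_empty]
    exact t.2.1
  refine ⟨T.max' hT, (Finset.mem_filter.1 (T.max'_mem hT)).2, fun h => ?_⟩
  by_contra! hcon
  have hmem : (⟨(T.max' hT : ℕ) + 1, h⟩ : Fin ℓ) ∈ T := by
    refine Finset.mem_filter.2 ⟨Finset.mem_univ _, ?_⟩
    have : Finset.Iio (⟨(T.max' hT : ℕ) + 1, h⟩ : Fin ℓ) = Finset.Iic (T.max' hT) := by
      ext a
      rw [Finset.mem_Iio, Finset.mem_Iic, Fin.lt_def, Fin.le_def]
      exact Nat.lt_succ_iff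
    rwa [this]
  have : (⟨(T.max' hT : ℕ) + 1, h⟩ : Fin ℓ) ≤ T.max' hT := T.le_max' _ hmem
  rw [Fin.le_def] at this
  simp at this

/-- The index of the interval that contains a point. -/
noncomputable def partIndex (hx : x ∈ stdSimplex ℝ (Fin ℓ)) (t : unitInterval) : Fin ℓ :=
  (exists_mem_part hx t).choose

theorem mem_part_iff (hx : x ∈ stdSimplex ℝ (Fin ℓ)) {t : unitInterval} {i : Fin ℓ} :
    t ∈ part x i ↔ partIndex hx t = i :=
  ⟨fun h => part_disjoint hx (exists_mem_part hx t).choose_spec h,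
    fun h => h ▸ (exists_mem_part hx t).choose_spec⟩

theorem completePartite_graph (hx : x ∈ stdSimplex ℝ (Fin ℓ)) :
    (completePartite x).graph = (⊤ : SimpleGraph (Fin ℓ)).comap (partIndex hx) := by
  ext s t
  have h : (completePartite x).toFun s t = 1 ↔ (s, t) ∈ crossPairs x := by
    change (crossPairs x).indicator 1 (s, t) = (1 : ℝ) ↔ _
    by_cases h : (s, t) ∈ crossPairs x <;> simp [h]
  have h' : (s, t) ∈ crossPairs x ↔ partIndex hx s ≠ partIndex hx t := by
    constructor
    · rintro ⟨i, j, hij, hi, hj⟩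
      rwa [(mem_part_iff hx).1 hi, (mem_part_iff hx).1 hj]
    · exact fun h => ⟨_, _, h, (mem_part_iff hx).2 rfl, (mem_part_iff hx).2 rfl⟩
  change s ≠ t ∧ (completePartite x).toFun s t = 1 ↔ partIndex hx s ≠ partIndex hx t
  rw [h, h']
  exact ⟨And.right, fun h => ⟨fun hst => h (congrArg _ hst), h⟩⟩

theorem volume_part (hx : x ∈ stdSimplex ℝ (Fin ℓ)) (i : Fin ℓ) :
    volume.real (part x i) = x i := by
  have hle : ∀ s : Finset (Fin ℓ), ∑ j ∈ s, x j ∈ unitInterval := fun s =>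
    ⟨Finset.sum_nonneg fun _ _ => hx.1 _, hx.2 ▸ Finset.sum_le_univ_sum_of_nonneg hx.1⟩
  have hsum : ∑ j ∈ Finset.Iic i, x j = x i + ∑ j ∈ Finset.Iio i, x j := by
    rw [← Finset.Iio_insert, Finset.sum_insert (by simp)]
  let a : unitInterval := ⟨_, hle (Finset.Iio i)⟩
  let b : unitInterval := ⟨_, hle (Finset.Iic i)⟩
  by_cases hi : (i : ℕ) + 1 < ℓ
  · have : part x i = Set.Ico a b := by
      ext t
      simp only [part, Set.mem_Ico, hi, forall_const]
      rfl
    rw [this, Measure.real, unitInterval.volume_Ico]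
    simp [a, b, hsum, hx.1 i]
  · have : part x i = Set.Ici a := by
      ext t
      simp only [part, hi, false_imp_iff, and_true]
      rfl
    have huniv : Finset.Iic i = Finset.univ := by
      ext j
      simp only [Finset.mem_Iic, Finset.mem_univ, iff_true, Fin.le_def]
      omega
    rw [huniv, hx.2] at hsum
    rw [this, Measure.real, unitInterval.volume_Ici]
    have : 1 - (a : ℝ) = x i := by simp [a, hsum]
    rw [this, ENNReal.toReal_ofReal (hx.1 i)]

end Parts

/-- Two distinct coordinates are independent and uniform, and the diagonal is null because points
are. -/
theorem ae_injective (r : ℕ) :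
    ∀ᵐ p : Fin r → unitInterval, Function.Injective p := by
  have hpair : ∀ i j : Fin r, i ≠ j → ∀ᵐ p : Fin r → unitInterval, p i ≠ p j := by
    intro i j hij
    have hind := (ProbabilityTheory.iIndepFun_pi
      (μ := fun _ : Fin r => (volume : Measure unitInterval)) (X := fun _ t => t) fun _ => aemeasurable_id).indepFun hij
    rw [ProbabilityTheory.indepFun_iff_map_prod_eq_prod_map_map
      (measurable_pi_apply i).aemeasurable (measurable_pi_apply j).aemeasurable] at hind
    have he : ∀ i : Fin r, Measure.map (fun p : Fin r → unitInterval => p i)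
        (Measure.pi fun _ => volume) = volume := fun i =>
      (measurePreserving_eval (fun _ : Fin r => (volume : Measure unitInterval)) i).map_eq
    rw [he, he] at hind
    have hdiag : MeasurableSet {q : unitInterval × unitInterval | q.1 = q.2} :=
      measurableSet_eq_fun measurable_fst measurable_snd
    have h0 : ((volume : Measure unitInterval).prod volume) {q | q.1 = q.2} = 0 := by
      rw [Measure.measure_prod_null hdiag]
      refine Filter.Eventually.of_forall fun s => ?_
      have : Prod.mk s ⁻¹' {q : unitInterval × unitInterval | q.1 = q.2} = {s} := by
        ext t; simp [eq_comm]
      simp [this]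
    rw [← hind, Measure.map_apply (by fun_prop) hdiag] at h0
    rw [ae_iff]
    simpa [volume_pi] using h0
  have : ∀ᵐ p : Fin r → unitInterval, ∀ i j : Fin r, i ≠ j → p i ≠ p j := by
    simp only [eventually_all]
    exact hpair
  filter_upwards [this] with p hp i j h
  by_contra hij
  exact hp i j hij h

/-- For almost every `p` the event depends only on which parts contain the points, so it is a
disjoint union of boxes of volume `∏ i, x (c i)`. -/
theorem density_completePartite {r ℓ : ℕ} (F : Set (SimpleGraph (Fin r))) {x : Fin ℓ → ℝ}
    (hx : x ∈ stdSimplex ℝ (Fin ℓ)) :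
    (completePartite x).density F = weightedDensity F (⊤ : SimpleGraph (Fin ℓ)) x := by
  classical
  let box : (Fin r → Fin ℓ) → Set (Fin r → unitInterval) := fun c =>
    Set.univ.pi fun i => part x (c i)
  have hbox : ∀ c p, p ∈ box c ↔ partIndex hx ∘ p = c := by
    intro c p
    simp [box, Set.mem_pi, mem_part_iff hx, funext_iff]
  have hae : {p : Fin r → unitInterval | Function.Injective p ∧
      ∃ A ∈ F, Nonempty ((completePartite x).graph.comap p ≃g A)} =ᵐ[volume]
      ⋃ c ∈ Finset.univ.filter fun c : Fin r → Fin ℓ =>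
        MemUpToIso F ((⊤ : SimpleGraph (Fin ℓ)).comap c), box c := by
    refine Filter.eventuallyEq_set.2 ?_
    filter_upwards [ae_injective r] with p hp
    simp only [Set.mem_iUnion, Finset.mem_filter, Finset.mem_univ, true_and, hbox, exists_prop,
      exists_eq_right', completePartite_graph hx, SimpleGraph.comap_comap]
    exact ⟨And.right, fun h => ⟨hp, h⟩⟩
  rw [Graphon.density, measureReal_congr hae, measureReal_biUnion_finset]
  · rw [weightedDensity, Finset.sum_filter]
    refine Finset.sum_congr rfl fun c _ => ?_
    rw [mul_ite, mul_one, mul_zero]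
    congr 1
    rw [Measure.real, volume_pi, Measure.pi_pi, ENNReal.toReal_prod]
    exact Finset.prod_congr rfl fun i _ => volume_part hx (c i)
  · intro c _ c' _ hne
    refine Set.disjoint_left.2 fun p hp hp' => hne ?_
    rw [← (hbox c p).1 hp, (hbox c' p).1 hp']
  · exact fun c _ => MeasurableSet.univ_pi fun i => measurableSet_part x (c i)

/-! ### The limit -/

theorem tendsto_maxDensity {V : Type*} [Finite V] {H : SimpleGraph V} (hne : H ≠ ⊥) {k : ℕ}
    (hH : H.Colorable k) {r : ℕ} {F : Set (SimpleGraph (Fin r))} (hF : IsSymmetrizable F) {ℓ : ℕ}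
    {x : Fin ℓ → ℝ} (hx : x ∈ stdSimplex ℝ (Fin ℓ)) (hpos : ∀ i, 0 < x i) (hℓ : ¬ H.Colorable ℓ)
    (hM : ∀ ℓ' < k, ∀ y ∈ stdSimplex ℝ (Fin ℓ'), weightedDensity F (⊤ : SimpleGraph (Fin ℓ')) y ≤
      weightedDensity F (⊤ : SimpleGraph (Fin ℓ)) x) :
    Tendsto (maxDensity H F) atTop (𝓝 (weightedDensity F (⊤ : SimpleGraph (Fin ℓ)) x)) := by
  refine tendsto_order.2 ⟨fun a ha => ?_, fun a ha => ?_⟩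
  · filter_upwards [eventually_ge_atTop r] with n hn
    exact ha.trans_le (le_maxDensity H hn F hx hpos hℓ)
  · filter_upwards [eventually_maxDensity_le hne hH hF (weightedDensity_nonneg F ⊤ hx.1) hM
      (half_pos (sub_pos.2 ha))] with n hn
    linarith

end Inducibility

theorem theorem1p3 {V : Type*} [Finite V] (H : SimpleGraph V) (hH : H ≠ ⊥)
    (k : ℕ) (hk : H.chromaticNumber = (k : ℕ∞))
    {r : ℕ} (F : Set (SimpleGraph (Fin r))) (hF : Inducibility.IsSymmetrizable F) :
    Tendsto (Inducibility.maxDensity H F) atTop (𝓝 (Inducibility.inducibility H F)) ∧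
    Tendsto (Inducibility.maxDensity (⊤ : SimpleGraph (Fin k)) F) atTop
      (𝓝 (Inducibility.inducibility (⊤ : SimpleGraph (Fin k)) F)) ∧
    Inducibility.inducibility H F = Inducibility.inducibility (⊤ : SimpleGraph (Fin k)) F ∧
    ∃ ℓ : ℕ, ℓ < k ∧ ∃ x : Fin ℓ → ℝ, x ∈ stdSimplex ℝ (Fin ℓ) ∧ (∀ i, 0 < x i) ∧
      H.Free (Inducibility.completePartite x).graph ∧
      Inducibility.Graphon.density F (Inducibility.completePartite x) =
        Inducibility.inducibility H F := by
  have hcol : ∀ ℓ, H.Colorable ℓ ↔ k ≤ ℓ := fun ℓ => by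
    rw [← SimpleGraph.chromaticNumber_le_iff_colorable, hk, Nat.cast_le]
  have hcolTop : ∀ ℓ, (⊤ : SimpleGraph (Fin k)).Colorable ℓ ↔ k ≤ ℓ := fun ℓ => by
    rw [← SimpleGraph.chromaticNumber_le_iff_colorable, SimpleGraph.chromaticNumber_top,
      Fintype.card_fin, Nat.cast_le]
  have hk2 : 2 ≤ k := by
    obtain ⟨a, b, hab⟩ := SimpleGraph.ne_bot_iff_exists_adj.1 hH
    have := SimpleGraph.two_le_chromaticNumber_of_adj hab
    rw [hk] at this
    exact_mod_cast this
  have hTop : (⊤ : SimpleGraph (Fin k)) ≠ ⊥ :=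
    SimpleGraph.ne_bot_iff_exists_adj.2 ⟨⟨0, by omega⟩, ⟨1, by omega⟩, by simp⟩
  -- The optimum depends only on `F` and `k`, so it serves `H` and the complete graph on `k`
  -- vertices alike.
  obtain ⟨ℓ, hℓ, x, hx, hpos, hmax⟩ := Inducibility.exists_optimal F hk2
  have h1 := Inducibility.tendsto_maxDensity hH ((hcol k).2 le_rfl) hF hx hpos
    (fun h => absurd ((hcol ℓ).1 h) (not_le.2 hℓ)) hmax
  have h2 := Inducibility.tendsto_maxDensity hTop ((hcolTop k).2 le_rfl) hF hx hpos
    (fun h => absurd ((hcolTop ℓ).1 h) (not_le.2 hℓ)) hmax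
  have e1 : Inducibility.inducibility H F = _ := h1.limUnder_eq
  have e2 : Inducibility.inducibility (⊤ : SimpleGraph (Fin k)) F = _ := h2.limUnder_eq
  refine ⟨e1 ▸ h1, e2 ▸ h2, e1.trans e2.symm, ℓ, hℓ, x, hx, hpos, ?_, ?_⟩
  · rw [Inducibility.completePartite_graph hx]
    exact Inducibility.free_comap_top ⟨fun f => absurd ((hcol ℓ).1 ⟨f⟩) (not_le.2 hℓ)⟩
  · rw [Inducibility.density_completePartite F hx, e1]
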